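/- All graphs are finite and simple. A graph is $k$-connected if it has more than $k$ vertices and remains connected after deleting any set of fewer than $k$ vertices; the connectivity $\kappa(G)$ is the largest $k$ for which $G$ is $k$-connected. Let $\delta(G)$ be the minimum degree of $G$ and let $\rho(G)$ be the spectral radius of $G$, i.e. the largest eigenvalue of its adjacency matrix. For integers $1\le k\le d\le n-1$ put $$G_{k,d,n}=K_k+(K_{d-k+1}\cup K_{n-d-1}),$$ where $\cup$ denotes disjoint union and $+$ denotes the join (all edges between the two parts are added; $K_0$ is the empty graph). **Theorem.** Let $n,k,d$ be positive integers with $k\le d$, and suppose that there is a graph $G$ of order $n$ with $\kappa(G)\le k$ and $\delta(G)\ge d$ (so that $d\le n-1$). Then $G_{k,d,n}$ is a connected graph of order $n$ with $\kappa(G_{k,d,n})\le k$ and minimum degree exactly $d$, and every graph $G$ of order $n$ with $\kappa(G)\le k$ and $\delta(G)\ge d$ satisfies $$\rho(G)\le\rho(G_{k,d,n}),$$ with equality if and only if $G\cong G_{k,d,n}$. In particular, among all connected graphs of order $n$ with connectivity at most $k$ and minimum degree $d$ (if there are any), the maximal spectral radius is attained uniquely, up to isomorphism, at $G_{k,d,n}$.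 -/

import Mathlib

namespace ConnSpec

/-- `G` is `k`-connected: it has more than `k` vertices, and deleting fewer than `k` vertices
always leaves a connected graph (so the complete graph on `k + 1` vertices is `k`-connected). -/
def IsKConnected {V : Type*} [Fintype V] (G : SimpleGraph V) (k : ℕ) : Prop :=
  k < Fintype.card V ∧
    ∀ S : Finset V, S.card < k → (G.induce {v : V | v ∉ S}).Connected

/-- The (vertex) connectivity `κ(G)`: the largest `k` for which `G` is `k`-connected. -/
noncomputable def connectivity {V : Type*} [Fintype V] (G : SimpleGraph V) : ℕ :=
  sSup {k : ℕ | IsKConnected G k}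

/-- The supremum defining the connectivity is a maximum. -/
theorem connectivity_isGreatest {V : Type*} [Fintype V] [Nonempty V] (G : SimpleGraph V) :
    IsGreatest {k : ℕ | IsKConnected G k} (connectivity G) := by
  have hbdd : BddAbove {k : ℕ | IsKConnected G k} := ⟨Fintype.card V, fun _ hk => hk.1.le⟩
  have hne : {k : ℕ | IsKConnected G k}.Nonempty :=
    ⟨0, Fintype.card_pos, fun _ hS => absurd hS (Nat.not_lt_zero _)⟩
  exact ⟨Nat.sSup_mem hne hbdd, fun _ hk => le_csSup hbdd hk⟩

/-- The spectral radius `ρ(G)`: the largest eigenvalue of the (real symmetric) adjacency matrix. -/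
noncomputable def specRadius {V : Type*} [Fintype V] [DecidableEq V] (G : SimpleGraph V)
    [DecidableRel G.Adj] : ℝ :=
  sSup (spectrum ℝ (G.adjMatrix ℝ))

/-- The supremum defining the spectral radius is a maximum. -/
theorem specRadius_isGreatest {V : Type*} [Fintype V] [DecidableEq V] [Nonempty V]
    (G : SimpleGraph V) [DecidableRel G.Adj] :
    IsGreatest (spectrum ℝ (G.adjMatrix ℝ)) (specRadius G) := by
  have hA : (G.adjMatrix ℝ).IsHermitian := by
    simp [Matrix.IsHermitian, Matrix.conjTranspose_eq_transpose_of_trivial]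
  have hs := hA.spectrum_real_eq_range_eigenvalues
  have hfin : (spectrum ℝ (G.adjMatrix ℝ)).Finite := hs ▸ Set.finite_range _
  have hne : (spectrum ℝ (G.adjMatrix ℝ)).Nonempty := hs ▸ Set.range_nonempty _
  exact ⟨hne.csSup_mem hfin, fun _ hx => le_csSup hfin.bddAbove hx⟩

/-- The join `G + H`: the disjoint union of `G` and `H` together with all edges between them. -/
def join {V W : Type*} (G : SimpleGraph V) (H : SimpleGraph W) : SimpleGraph (V ⊕ W) :=
  G.sum H ⊔ completeBipartiteGraph V W

/-- The graph `K_k + (K_{δ-k+1} ∪ K_{n-δ-1})`, for `k ≤ δ ≤ n - 1`. -/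
def extremalGraph (k δ n : ℕ) :
    SimpleGraph (Fin k ⊕ (Fin (δ - k + 1) ⊕ Fin (n - δ - 1))) :=
  join (⊤ : SimpleGraph (Fin k))
    ((⊤ : SimpleGraph (Fin (δ - k + 1))).sum (⊤ : SimpleGraph (Fin (n - δ - 1))))

noncomputable instance extremalGraph.instDecidableRelAdj (k δ n : ℕ) :
    DecidableRel (extremalGraph k δ n).Adj :=
  Classical.decRel _

end ConnSpec

/-! A vertex cut of at most `k` vertices splits the rest of `G` into nonadjacent parts, the smaller
of which, with the cut, contains a closed neighbourhood and so has more than `δ` vertices. Padding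
the cut to exactly `k` vertices gives `G ≤ sepGraph A B` with `δ - k + 1 ≤ |A| ≤ |B|`, apart from
the complete case `n = k + 1` (`exists_le_sepGraph`).

Let `x` be a Perron vector of `sepGraph A B` with total weight `σ` and weights `a`, `b` on the
parts. The quadratic form is `σ² - x·x - 2ab`, and the larger part is the heavier
(`sum_le_sum_of_card_le`). Moving weight `t` from `A` to `B` replaces `ab` by `(a - t)(b + t) < ab`,
so `ρ` strictly increases (`specRadius_sepGraph_lt`). Shrinking `A` to `δ - k + 1` vertices yields
the extremal graph. Equality allows no move, and then `G = sepGraph A B` by strict Perron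
monotonicity (`eq_of_le_of_specRadius_eq`). -/

namespace ConnSpec

open Matrix Finset

/-! ### Perron–Frobenius theory via the Rayleigh quotient. -/

section Spectral

variable {V : Type*} [Fintype V]

/-- A nonnegative eigenvector of a connected graph is positive. -/
theorem eigenvector_pos {G : SimpleGraph V} [DecidableRel G.Adj] (hG : G.Connected) {x : V → ℝ}
    {r : ℝ} (hx : x ≠ 0) (h0 : ∀ i, 0 ≤ x i) (h : G.adjMatrix ℝ *ᵥ x = r • x) (i : V) :
    0 < x i := by
  refine (h0 i).lt_of_ne' fun hi => hx (funext fun j => ?_)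
  -- Zeros spread along edges: if `x v = 0`, the neighbour sum at `v` is zero with nonnegative
  -- terms.
  have step : ∀ v w, G.Adj v w → x v = 0 → x w = 0 := fun v w hvw hv => by
    have := congrFun h v
    rw [SimpleGraph.adjMatrix_mulVec_apply, Pi.smul_apply, hv, smul_zero,
      sum_eq_zero_iff_of_nonneg fun u _ => h0 u] at this
    exact this w ((G.mem_neighborFinset v w).mpr hvw)
  obtain ⟨p⟩ := hG.preconnected i j
  induction p with
  | nil => exact hi
  | cons hadj _ ih => exact ih (step _ _ hadj hi)

theorem dotProduct_adjMatrix_mono {G H : SimpleGraph V} [DecidableRel G.Adj] [DecidableRel H.Adj]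
    (hGH : G ≤ H) {x : V → ℝ} (h0 : ∀ i, 0 ≤ x i) :
    x ⬝ᵥ (G.adjMatrix ℝ *ᵥ x) ≤ x ⬝ᵥ (H.adjMatrix ℝ *ᵥ x) := by
  rw [SimpleGraph.dotProduct_mulVec_adjMatrix, SimpleGraph.dotProduct_mulVec_adjMatrix]
  refine sum_le_sum fun i _ => sum_le_sum fun j _ => ?_
  split_ifs with h1 h2 h2
  · exact le_rfl
  · exact absurd (hGH h1) h2
  · exact mul_nonneg (h0 i) (h0 j)
  · exact le_rfl

theorem dotProduct_self_pos_of_ne_zero {x : V → ℝ} (hx : x ≠ 0) : 0 < x ⬝ᵥ x := by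
  simpa using dotProduct_star_self_pos_iff.mpr hx

variable [DecidableEq V] {W : Type*} [Fintype W] [DecidableEq W]

/-- The spectral radius is invariant under graph isomorphism. -/
theorem specRadius_congr {G : SimpleGraph V} [DecidableRel G.Adj] {H : SimpleGraph W}
    [DecidableRel H.Adj] (e : G ≃g H) : specRadius G = specRadius H := by
  unfold specRadius
  have h : H.adjMatrix ℝ = Matrix.reindexAlgEquiv ℝ ℝ e.toEquiv (G.adjMatrix ℝ) := by
    rw [Matrix.coe_reindexAlgEquiv]
    exact (e.reindex_adjMatrix ℝ).symm
  rw [h, AlgEquiv.spectrum_eq]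

/-- The eigenvalues of `ρI - A` are `ρ - λ ≥ 0`. Nonnegativity of its form is the Rayleigh bound;
since a semidefinite form vanishes only on the kernel, equality forces an eigenvector. -/
theorem posSemidef_specRadius_sub (G : SimpleGraph V) [DecidableRel G.Adj] :
    (algebraMap ℝ (Matrix V V ℝ) (specRadius G) - G.adjMatrix ℝ).PosSemidef := by
  rcases isEmpty_or_nonempty V with hV | hV
  · rw [Subsingleton.elim (algebraMap ℝ (Matrix V V ℝ) (specRadius G) - G.adjMatrix ℝ) 0]
    exact Matrix.PosSemidef.zero
  · rw [Matrix.posSemidef_iff_isHermitian_and_spectrum_nonneg]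
    constructor
    · ext i j
      simp [Matrix.algebraMap_matrix_apply, SimpleGraph.adj_comm, eq_comm]
    · rw [← spectrum.singleton_sub_eq]
      rintro _ ⟨r, hr, s, hs, rfl⟩
      rw [Set.mem_singleton_iff.mp hr]
      exact sub_nonneg.mpr ((specRadius_isGreatest G).2 hs)

theorem dotProduct_specRadius_sub (G : SimpleGraph V) [DecidableRel G.Adj] (x : V → ℝ) :
    star x ⬝ᵥ ((algebraMap ℝ (Matrix V V ℝ) (specRadius G) - G.adjMatrix ℝ) *ᵥ x) =
      specRadius G * (x ⬝ᵥ x) - x ⬝ᵥ (G.adjMatrix ℝ *ᵥ x) := by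
  rw [Matrix.sub_mulVec, dotProduct_sub, Algebra.algebraMap_eq_smul_one, Matrix.smul_mulVec,
    Matrix.one_mulVec, dotProduct_smul, star_trivial, smul_eq_mul]

/-- The Rayleigh quotient is bounded by the spectral radius. -/
theorem dotProduct_adjMatrix_le (G : SimpleGraph V) [DecidableRel G.Adj] (x : V → ℝ) :
    x ⬝ᵥ (G.adjMatrix ℝ *ᵥ x) ≤ specRadius G * (x ⬝ᵥ x) := by
  have h := (posSemidef_specRadius_sub G).dotProduct_mulVec_nonneg x
  rw [dotProduct_specRadius_sub] at h
  linarith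

/-- A vector attaining the maximal Rayleigh quotient is an eigenvector. -/
theorem mulVec_eq_of_dotProduct_ge (G : SimpleGraph V) [DecidableRel G.Adj] {x : V → ℝ}
    (h : specRadius G * (x ⬝ᵥ x) ≤ x ⬝ᵥ (G.adjMatrix ℝ *ᵥ x)) :
    G.adjMatrix ℝ *ᵥ x = specRadius G • x := by
  have h0 := ((posSemidef_specRadius_sub G).dotProduct_mulVec_zero_iff x).mp (by
    rw [dotProduct_specRadius_sub]
    linarith [dotProduct_adjMatrix_le G x])
  rw [Matrix.sub_mulVec, Algebra.algebraMap_eq_smul_one, Matrix.smul_mulVec,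
    Matrix.one_mulVec] at h0
  exact (sub_eq_zero.mp h0).symm

/-- The spectral radius has a nonnegative eigenvector. -/
theorem exists_nonneg_eigenvector [Nonempty V] (G : SimpleGraph V) [DecidableRel G.Adj] :
    ∃ x : V → ℝ, x ≠ 0 ∧ (∀ i, 0 ≤ x i) ∧ G.adjMatrix ℝ *ᵥ x = specRadius G • x := by
  have hmem := (specRadius_isGreatest G).1
  rw [← Matrix.spectrum_toLin', ← Module.End.hasEigenvalue_iff_mem_spectrum] at hmem
  obtain ⟨u, hu⟩ := hmem.exists_hasEigenvector
  have hu' : G.adjMatrix ℝ *ᵥ u = specRadius G • u := by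
    simpa using hu.apply_eq_smul
  -- Passing to `|u|` keeps the norm and cannot decrease the quadratic form, so `|u|` is again a
  -- maximiser.
  refine ⟨fun i => |u i|, fun h => hu.2 (funext fun i => by simpa using congrFun h i),
    fun i => abs_nonneg _, mulVec_eq_of_dotProduct_ge G ?_⟩
  have h1 : (fun i => |u i|) ⬝ᵥ (fun i => |u i|) = u ⬝ᵥ u := by
    simp [dotProduct]
  have h2 : specRadius G * (u ⬝ᵥ u) = u ⬝ᵥ (G.adjMatrix ℝ *ᵥ u) := by
    rw [hu', dotProduct_smul, smul_eq_mul]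
  rw [h1, h2, SimpleGraph.dotProduct_mulVec_adjMatrix, SimpleGraph.dotProduct_mulVec_adjMatrix]
  refine sum_le_sum fun i _ => sum_le_sum fun j _ => ?_
  split_ifs
  · rw [← abs_mul]
    exact le_abs_self _
  · exact le_rfl

/-- The spectral radius is monotone in the graph. -/
theorem specRadius_mono {G H : SimpleGraph V} [DecidableRel G.Adj] [DecidableRel H.Adj]
    [Nonempty V] (hGH : G ≤ H) : specRadius G ≤ specRadius H := by
  obtain ⟨x, hx, h0, hGx⟩ := exists_nonneg_eigenvector G
  have h1 := (dotProduct_adjMatrix_mono hGH h0).trans (dotProduct_adjMatrix_le H x)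
  rw [hGx, dotProduct_smul, smul_eq_mul] at h1
  exact le_of_mul_le_mul_right h1 (dotProduct_self_pos_of_ne_zero hx)

/-- The spectral radius is strictly monotone below a connected graph. -/
theorem eq_of_le_of_specRadius_eq {G H : SimpleGraph V} [DecidableRel G.Adj] [DecidableRel H.Adj]
    (hH : H.Connected) (hGH : G ≤ H) (h : specRadius G = specRadius H) : G = H := by
  have := hH.nonempty
  obtain ⟨x, hx, h0, hGx⟩ := exists_nonneg_eigenvector G
  have hHx : H.adjMatrix ℝ *ᵥ x = specRadius H • x := by
    refine mulVec_eq_of_dotProduct_ge H ((le_of_eq ?_).trans (dotProduct_adjMatrix_mono hGH h0))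
    rw [hGx, dotProduct_smul, smul_eq_mul, h]
  have hpos := eigenvector_pos hH hx h0 hHx
  refine le_antisymm hGH fun v w hvw => ?_
  have hv : ∑ u ∈ G.neighborFinset v, x u = ∑ u ∈ H.neighborFinset v, x u := by
    rw [← SimpleGraph.adjMatrix_mulVec_apply, ← SimpleGraph.adjMatrix_mulVec_apply, hGx, hHx, h]
  by_contra hn
  -- An edge `vw` missing from `G` would make the neighbour sum of `v` in `H` larger by at least `x
  -- w > 0`.
  refine hv.not_lt (sum_lt_sum_of_subset (i := w) (fun u hu => ?_) ?_ ?_ (hpos w)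
    fun u _ _ => h0 u)
  · exact (H.mem_neighborFinset v u).mpr (hGH ((G.mem_neighborFinset v u).mp hu))
  · exact (H.mem_neighborFinset v w).mpr hvw
  · exact fun hw => hn ((G.mem_neighborFinset v w).mp hw)

end Spectral

/-! ### Complete graphs with all edges between two disjoint sets removed. -/

section Separated

variable {V W : Type*}

/-- The graph on `V` in which all pairs of distinct vertices are adjacent, except for those
with one vertex in `A` and one in `B`. -/
def sepGraph (A B : Finset V) : SimpleGraph V where
  Adj u v := u ≠ v ∧ ¬(u ∈ A ∧ v ∈ B) ∧ ¬(u ∈ B ∧ v ∈ A)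
  symm.symm _ _ h := ⟨h.1.symm, fun h' => h.2.2 h'.symm, fun h' => h.2.1 h'.symm⟩

instance [DecidableEq V] (A B : Finset V) : DecidableRel (sepGraph A B).Adj :=
  fun u v => inferInstanceAs (Decidable (u ≠ v ∧ ¬(u ∈ A ∧ v ∈ B) ∧ ¬(u ∈ B ∧ v ∈ A)))

theorem sepGraph_adj {A B : Finset V} {u v : V} :
    (sepGraph A B).Adj u v ↔ u ≠ v ∧ ¬(u ∈ A ∧ v ∈ B) ∧ ¬(u ∈ B ∧ v ∈ A) := Iff.rfl

theorem sepGraph_connected {A B : Finset V} {s : V} (hA : s ∉ A) (hB : s ∉ B) :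
    (sepGraph A B).Connected := by
  have h : ∀ v, (sepGraph A B).Reachable s v := fun v => by
    by_cases hv : s = v
    · exact hv ▸ SimpleGraph.Reachable.refl _
    · exact SimpleGraph.Adj.reachable ⟨hv, fun h => hA h.1, fun h => hB h.1⟩
  exact (SimpleGraph.connected_iff _).mpr ⟨fun u v => (h u).symm.trans (h v), ⟨s⟩⟩

/-- Separated graphs with parts of the same sizes are isomorphic. -/
theorem nonempty_iso_sepGraph [Fintype V] [Fintype W] [DecidableEq V] [DecidableEq W]
    {A B : Finset V} {C D : Finset W} (hAB : Disjoint A B) (hCD : Disjoint C D)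
    (hA : A.card = C.card) (hB : B.card = D.card) (hV : Fintype.card V = Fintype.card W) :
    Nonempty (sepGraph A B ≃g sepGraph C D) := by
  -- Adjacency of distinct vertices depends only on their membership pattern, so any bijection
  -- matching the patterns is an isomorphism.
  let f : V → Bool × Bool := fun v => (decide (v ∈ A), decide (v ∈ B))
  let g : W → Bool × Bool := fun w => (decide (w ∈ C), decide (w ∈ D))
  have hcard : ∀ c, Fintype.card {v // f v = c} = Fintype.card {w // g w = c} := by
    have h₁ : univ.filter (fun v => v ∈ A ∧ v ∉ B) = A := by
      ext v
      simpa using fun h => Finset.disjoint_left.mp hAB h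
    have h₂ : univ.filter (fun v => v ∈ C ∧ v ∉ D) = C := by
      ext v
      simpa using fun h => Finset.disjoint_left.mp hCD h
    have h₃ : univ.filter (fun v => v ∉ A ∧ v ∈ B) = B := by
      ext v
      simpa using fun h => Finset.disjoint_right.mp hAB h
    have h₄ : univ.filter (fun v => v ∉ C ∧ v ∈ D) = D := by
      ext v
      simpa using fun h => Finset.disjoint_right.mp hCD h
    have h₅ : univ.filter (fun v => v ∈ A ∧ v ∈ B) = ∅ :=
      filter_eq_empty_iff.mpr fun v _ h => Finset.disjoint_left.mp hAB h.1 h.2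
    have h₆ : univ.filter (fun v => v ∈ C ∧ v ∈ D) = ∅ :=
      filter_eq_empty_iff.mpr fun v _ h => Finset.disjoint_left.mp hCD h.1 h.2
    have h₇ : (univ.filter fun v => v ∉ A ∧ v ∉ B).card =
        (univ.filter fun v => v ∉ C ∧ v ∉ D).card := by
      simp only [← not_or, ← mem_union, filter_not, filter_mem_eq_inter, univ_inter,
        ← compl_eq_univ_sdiff, card_compl, card_union_of_disjoint hAB, card_union_of_disjoint hCD,
        hA, hB, hV]
    rintro ⟨_ | _, _ | _⟩ <;>
      simp [f, g, Fintype.card_subtype, h₁, h₂, h₃, h₄, h₅, h₆, h₇, hA, hB]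
  let e : V ≃ W := Equiv.ofFiberEquiv fun c => Fintype.equivOfCardEq (hcard c)
  have he : ∀ v, g (e v) = f v := fun v => Equiv.ofFiberEquiv_map _ v
  have heA : ∀ v, e v ∈ C ↔ v ∈ A := fun v => by
    simpa [f, g] using congrArg Prod.fst (he v)
  have heB : ∀ v, e v ∈ D ↔ v ∈ B := fun v => by
    simpa [f, g] using congrArg Prod.snd (he v)
  exact ⟨⟨e, fun {u v} => by simp [sepGraph_adj, heA, heB]⟩⟩

variable [Fintype V]

theorem connectivity_le_of_card_le {k : ℕ} (G : SimpleGraph V) [Nonempty V]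
    (h : Fintype.card V ≤ k + 1) : connectivity G ≤ k := by
  have := (connectivity_isGreatest G).1.1
  omega

variable [DecidableEq V] {A B : Finset V}

/-- The adjacency matrix is `J - I - 1_A 1_Bᵀ - 1_B 1_Aᵀ`; disjointness prevents double subtraction.
-/
theorem sepGraph_adjMatrix_mulVec (hAB : Disjoint A B) (x : V → ℝ) (v : V) :
    ((sepGraph A B).adjMatrix ℝ *ᵥ x) v =
      ∑ u, x u - x v - (if v ∈ A then ∑ u ∈ B, x u else 0) -
        (if v ∈ B then ∑ u ∈ A, x u else 0) := by
  have h : ∀ u, (if (sepGraph A B).Adj v u then (1 : ℝ) else 0) * x u =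
      x u - (if v = u then x u else 0) - (if v ∈ A then if u ∈ B then x u else 0 else 0) -
        (if v ∈ B then if u ∈ A then x u else 0 else 0) := fun u => by
    have h₁ : u ∈ A → u ∉ B := fun h => Finset.disjoint_left.mp hAB h
    have h₂ : v ∈ A → v ∉ B := fun h => Finset.disjoint_left.mp hAB h
    by_cases huv : v = u
    · subst huv
      by_cases hA : v ∈ A <;> by_cases hB : v ∈ B <;> simp_all
    · by_cases hA : v ∈ A <;> by_cases hB : v ∈ B <;> by_cases hA' : u ∈ A <;>
        by_cases hB' : u ∈ B <;> simp_all [sepGraph_adj]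
  simp only [Matrix.mulVec, dotProduct, SimpleGraph.adjMatrix_apply, h, sum_sub_distrib]
  congr 1
  · congr 1
    · simp
    · split_ifs <;> simp
  · split_ifs <;> simp

theorem sepGraph_dotProduct (hAB : Disjoint A B) (x : V → ℝ) :
    x ⬝ᵥ ((sepGraph A B).adjMatrix ℝ *ᵥ x) =
      (∑ u, x u) ^ 2 - x ⬝ᵥ x - 2 * (∑ u ∈ A, x u) * ∑ u ∈ B, x u := by
  have h : ∀ (C : Finset V) (c : ℝ),
      ∑ v, x v * (if v ∈ C then c else 0) = (∑ v ∈ C, x v) * c := fun C c => by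
    simp [sum_mul]
  simp only [dotProduct, sepGraph_adjMatrix_mulVec hAB, mul_sub, sum_sub_distrib, h, ← sum_mul]
  ring

/-- In a Perron vector of a separated graph, the larger part carries the larger weight. -/
theorem sum_le_sum_of_card_le (hAB : Disjoint A B) {s : V} (hsA : s ∉ A) (hsB : s ∉ B)
    (hcard : A.card ≤ B.card) {x : V → ℝ} {r : ℝ} (hx : ∀ v, 0 < x v)
    (h : (sepGraph A B).adjMatrix ℝ *ᵥ x = r • x) : ∑ u ∈ A, x u ≤ ∑ u ∈ B, x u := by
  rcases A.eq_empty_or_nonempty with rfl | hA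
  · simpa using sum_nonneg fun u _ => (hx u).le
  have hB : B.Nonempty := card_pos.mp (hA.card_pos.trans_le hcard)
  set a := ∑ u ∈ A, x u with ha
  set b := ∑ u ∈ B, x u with hb
  have hapos : 0 < a := sum_pos (fun u _ => hx u) hA
  have hbpos : 0 < b := sum_pos (fun u _ => hx u) hB
  have hS : 0 < ∑ u, x u - a - b := by
    have h1 : a + b < ∑ u, x u := by
      rw [ha, hb, ← sum_union hAB]
      exact sum_lt_sum_of_subset (subset_univ _) (mem_univ s)
        (by simp [hsA, hsB]) (hx s) fun u _ _ => (hx u).le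
    linarith
  have hAx : ∀ v ∈ A, (r + 1) * x v = ∑ u, x u - b := fun v hv => by
    have := congrFun h v
    rw [sepGraph_adjMatrix_mulVec hAB, if_pos hv, if_neg (Finset.disjoint_left.mp hAB hv),
      Pi.smul_apply, smul_eq_mul] at this
    linarith
  have hBx : ∀ v ∈ B, (r + 1) * x v = ∑ u, x u - a := fun v hv => by
    have := congrFun h v
    rw [sepGraph_adjMatrix_mulVec hAB, if_pos hv, if_neg (Finset.disjoint_right.mp hAB hv),
      Pi.smul_apply, smul_eq_mul] at this
    linarith
  have hAs : (r + 1) * a = A.card * (∑ u, x u - b) := by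
    rw [ha, mul_sum, sum_congr rfl hAx, sum_const, nsmul_eq_mul]
  have hBs : (r + 1) * b = B.card * (∑ u, x u - a) := by
    rw [hb, mul_sum, sum_congr rfl hBx, sum_const, nsmul_eq_mul]
  have hc : (A.card : ℝ) ≤ B.card := by exact_mod_cast hcard
  have hA0 : (0 : ℝ) < A.card := by exact_mod_cast hA.card_pos
  -- Isolating the weight `σ - a - b > 0` outside both parts makes the two equations comparable.
  have h1 : (r + 1 - A.card) * a = A.card * (∑ u, x u - a - b) := by linarith
  have h2 : (r + 1 - B.card) * b = B.card * (∑ u, x u - a - b) := by linarith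
  have h3 : 0 < r + 1 - A.card := by
    refine pos_of_mul_pos_left ?_ hapos.le
    rw [h1]
    exact mul_pos hA0 hS
  refine le_of_mul_le_mul_left ?_ h3
  calc (r + 1 - A.card) * a = A.card * (∑ u, x u - a - b) := h1
    _ ≤ B.card * (∑ u, x u - a - b) := mul_le_mul_of_nonneg_right hc hS.le
    _ = (r + 1 - B.card) * b := h2.symm
    _ ≤ (r + 1 - A.card) * b := mul_le_mul_of_nonneg_right (by linarith) hbpos.le

/-- Moving vertices from the smaller part to the larger one increases the spectral radius. -/
theorem specRadius_sepGraph_lt (hAB : Disjoint A B) {s : V} (hsA : s ∉ A) (hsB : s ∉ B)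
    (hcard : A.card ≤ B.card) {T : Finset V} (hTA : T ⊆ A) (hT : T.Nonempty) :
    specRadius (sepGraph A B) < specRadius (sepGraph (A \ T) (B ∪ T)) := by
  have : Nonempty V := ⟨s⟩
  obtain ⟨x, hx, h0, h⟩ := exists_nonneg_eigenvector (sepGraph A B)
  have hpos := eigenvector_pos (sepGraph_connected hsA hsB) hx h0 h
  have hdisj : Disjoint (A \ T) (B ∪ T) :=
    disjoint_union_right.mpr ⟨hAB.mono_left sdiff_subset, sdiff_disjoint⟩
  have hle := dotProduct_adjMatrix_le (sepGraph (A \ T) (B ∪ T)) x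
  have heq : x ⬝ᵥ ((sepGraph A B).adjMatrix ℝ *ᵥ x) = specRadius (sepGraph A B) * (x ⬝ᵥ x) := by
    rw [h, dotProduct_smul, smul_eq_mul]
  have hAT : ∑ u ∈ A \ T, x u = ∑ u ∈ A, x u - ∑ u ∈ T, x u :=
    eq_sub_of_add_eq (sum_sdiff hTA)
  rw [sepGraph_dotProduct hdisj, sum_union (hAB.symm.mono_right hTA), hAT] at hle
  rw [sepGraph_dotProduct hAB] at heq
  have hTpos : 0 < ∑ u ∈ T, x u := sum_pos (fun u _ => hpos u) hT
  have hab := sum_le_sum_of_card_le hAB hsA hsB hcard hpos h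
  -- This is `ab - (a - t)(b + t) = t(b - a + t)`, half the gain in the quadratic form.
  have hgain : 0 < (∑ u ∈ T, x u) * (∑ u ∈ B, x u - ∑ u ∈ A, x u + ∑ u ∈ T, x u) :=
    mul_pos hTpos (by linarith)
  refine lt_of_mul_lt_mul_right ?_ (dotProduct_self_pos_of_ne_zero hx).le
  linarith

theorem connectivity_sepGraph_le (hAB : Disjoint A B) (hA : A.Nonempty) (hB : B.Nonempty) :
    connectivity (sepGraph A B) ≤ Fintype.card V - (A.card + B.card) := by
  obtain ⟨a, ha⟩ := hA
  obtain ⟨b, hb⟩ := hB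
  have : Nonempty V := ⟨a⟩
  by_contra! hlt
  rw [← card_union_of_disjoint hAB, ← card_compl] at hlt
  have hc := (connectivity_isGreatest (sepGraph A B)).1.2 _ hlt
  -- Once the vertices outside `A ∪ B` are deleted, no walk can leave `A`.
  have key : ∀ u v, ((sepGraph A B).induce {v | v ∉ (A ∪ B)ᶜ}).Reachable u v →
      u.1 ∈ A → v.1 ∈ A := by
    rintro u v ⟨p⟩
    induction p with
    | nil => exact id
    | @cons u v w hadj _ ih =>
      intro hu
      refine ih ?_
      have hv : v.1 ∈ A ∨ v.1 ∈ B := by simpa [or_iff_not_imp_left] using v.2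
      exact hv.resolve_right fun hvB => hadj.2.1 ⟨hu, hvB⟩
  exact Finset.disjoint_right.mp hAB hb
    (key ⟨a, by simp [ha]⟩ ⟨b, by simp [hb]⟩ (hc.preconnected _ _) ha)

/-- The minimum is attained on `A`, whose vertices miss the larger part. An empty `B` gives the
complete graph, where no size comparison is needed. Taking `H` up to equality leaves its
decidability instance arbitrary. -/
theorem minDegree_of_eq_sepGraph {H : SimpleGraph V} [DecidableRel H.Adj]
    (hH : H = sepGraph A B) (hAB : Disjoint A B) (hA : A.Nonempty)
    (hcard : B.Nonempty → A.card ≤ B.card) :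
    H.minDegree = Fintype.card V - B.card - 1 := by
  subst hH
  have hdegA : ∀ v ∈ A, (sepGraph A B).degree v = Fintype.card V - B.card - 1 := fun v hv => by
    have hvB := Finset.disjoint_left.mp hAB hv
    rw [← card_compl, ← card_erase_of_mem (mem_compl.mpr hvB),
      ← SimpleGraph.card_neighborFinset_eq_degree]
    congr 1
    ext w
    simp [sepGraph_adj, hv, hvB, eq_comm]
  have hdegB : ∀ v ∈ B, (sepGraph A B).degree v = Fintype.card V - A.card - 1 := fun v hv => by
    have hvA := Finset.disjoint_right.mp hAB hv
    rw [← card_compl, ← card_erase_of_mem (mem_compl.mpr hvA),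
      ← SimpleGraph.card_neighborFinset_eq_degree]
    congr 1
    ext w
    simp [sepGraph_adj, hv, hvA, eq_comm]
  have hdeg : ∀ v, v ∉ A → v ∉ B → (sepGraph A B).degree v = Fintype.card V - 1 :=
    fun v hvA hvB => by
      rw [← card_univ, ← card_erase_of_mem (mem_univ v),
        ← SimpleGraph.card_neighborFinset_eq_degree]
      congr 1
      ext w
      simp [sepGraph_adj, hvA, hvB, eq_comm]
  obtain ⟨a, ha⟩ := hA
  have : Nonempty V := ⟨a⟩
  refine le_antisymm (hdegA a ha ▸ SimpleGraph.minDegree_le_degree _ a)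
    (SimpleGraph.le_minDegree_of_forall_le_degree _ _ fun v => ?_)
  by_cases hvA : v ∈ A
  · exact (hdegA v hvA).ge
  · by_cases hvB : v ∈ B
    · rw [hdegB v hvB]
      have := hcard ⟨v, hvB⟩
      omega
    · rw [hdeg v hvA hvB]
      omega

end Separated

/-! ### The extremal graph as a separated graph. -/

section Extremal

/-- The vertices of the clique of order `δ - k + 1` in the extremal graph. -/
def extremalLeft (k a b : ℕ) : Finset (Fin k ⊕ (Fin a ⊕ Fin b)) :=
  univ.map (Function.Embedding.inl.trans Function.Embedding.inr)

/-- The vertices of the clique of order `n - δ - 1` in the extremal graph. -/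
def extremalRight (k a b : ℕ) : Finset (Fin k ⊕ (Fin a ⊕ Fin b)) :=
  univ.map (Function.Embedding.inr.trans Function.Embedding.inr)

theorem card_extremalLeft (k a b : ℕ) : (extremalLeft k a b).card = a := by
  simp [extremalLeft]

theorem card_extremalRight (k a b : ℕ) : (extremalRight k a b).card = b := by
  simp [extremalRight]

theorem disjoint_extremalLeft_extremalRight (k a b : ℕ) :
    Disjoint (extremalLeft k a b) (extremalRight k a b) := by
  simp [extremalLeft, extremalRight, Finset.disjoint_left]

theorem extremalGraph_eq_sepGraph (k δ n : ℕ) :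
    extremalGraph k δ n =
      sepGraph (extremalLeft k (δ - k + 1) (n - δ - 1))
        (extremalRight k (δ - k + 1) (n - δ - 1)) := by
  ext u v
  rcases u with u | u | u <;> rcases v with v | v | v <;>
    simp [extremalGraph, join, sepGraph_adj, extremalLeft, extremalRight]

end Extremal

/-! ### From low connectivity to a containing separated graph. -/

section Structure

variable {V : Type*} [Fintype V] [DecidableEq V]

/-- A vertex of `A` has its whole closed neighbourhood inside `A ∪ S`. -/
theorem lt_card_add_card_of_separated {G : SimpleGraph V} [DecidableRel G.Adj] {A S : Finset V}
    (h : ∀ u ∈ A, ∀ v, G.Adj u v → v ∈ A ∪ S) (hA : A.Nonempty) :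
    G.minDegree < A.card + S.card := by
  obtain ⟨a, ha⟩ := hA
  have hsub : G.neighborFinset a ⊆ (A ∪ S).erase a := fun v hv => by
    rw [SimpleGraph.mem_neighborFinset] at hv
    exact mem_erase.mpr ⟨hv.ne', h a ha v hv⟩
  have h1 := card_le_card hsub
  have haS : a ∈ A ∪ S := mem_union_left _ ha
  rw [card_erase_of_mem haS, SimpleGraph.card_neighborFinset_eq_degree] at h1
  have h2 := G.minDegree_le_degree a
  have h3 := card_union_le A S
  have h4 := card_pos.mpr ⟨a, haS⟩
  omega

/-- A disconnected vertex-deleted subgraph splits into two nonempty separated parts. -/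
theorem exists_separation {G : SimpleGraph V} {S : Finset V} (hS : S.card < Fintype.card V)
    (hG : ¬ (G.induce {v : V | v ∉ S}).Connected) :
    ∃ A B : Finset V, A.Nonempty ∧ B.Nonempty ∧ Disjoint A B ∧ A ∪ B = Sᶜ ∧
      ∀ u ∈ A, ∀ v ∈ B, ¬ G.Adj u v := by
  classical
  obtain ⟨w, -, hw⟩ := exists_mem_notMem_of_card_lt_card (by rwa [← card_univ] at hS)
  have : Nonempty {v : V | v ∉ S} := ⟨⟨w, hw⟩⟩
  have hpre : ¬ (G.induce {v : V | v ∉ S}).Preconnected := fun h =>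
    hG ((SimpleGraph.connected_iff _).mpr ⟨h, this⟩)
  simp only [SimpleGraph.Preconnected, not_forall] at hpre
  obtain ⟨a, b, hab⟩ := hpre
  refine ⟨univ.filter fun v => ∃ h : v ∉ S, (G.induce {v : V | v ∉ S}).Reachable a ⟨v, h⟩,
    univ.filter fun v => ∃ h : v ∉ S, ¬ (G.induce {v : V | v ∉ S}).Reachable a ⟨v, h⟩,
    ⟨a, mem_filter.mpr ⟨mem_univ _, a.2, SimpleGraph.Reachable.refl _⟩⟩,
    ⟨b, mem_filter.mpr ⟨mem_univ _, b.2, hab⟩⟩,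
    ?_, ?_, ?_⟩
  · rw [disjoint_filter]
    rintro v - ⟨_, h1⟩ ⟨_, h2⟩
    exact h2 h1
  · ext v
    simp only [mem_union, mem_filter, mem_univ, true_and, mem_compl]
    exact ⟨fun h => h.elim Exists.fst Exists.fst, fun h => by
      by_cases hr : (G.induce {v : V | v ∉ S}).Reachable a ⟨v, h⟩
      exacts [Or.inl ⟨h, hr⟩, Or.inr ⟨h, hr⟩]⟩
  · simp only [mem_filter, mem_univ, true_and]
    rintro u ⟨hu, hau⟩ v ⟨hv, hav⟩ huv
    refine hav (hau.trans (SimpleGraph.Adj.reachable ?_))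
    exact huv

/-- A graph with connectivity at most `k` and minimum degree at least `δ` is contained in a
separated graph. -/
theorem exists_le_sepGraph {k δ : ℕ} (hkδ : k ≤ δ) {G : SimpleGraph V} [DecidableRel G.Adj]
    (hconn : connectivity G ≤ k) (hdeg : δ ≤ G.minDegree) (hδ : δ < Fintype.card V) :
    ∃ A B : Finset V, Disjoint A B ∧ k + A.card + B.card = Fintype.card V ∧ G ≤ sepGraph A B ∧
      δ - k + 1 ≤ A.card ∧ (B = ∅ ∧ Fintype.card V = k + 1 ∨ A.card ≤ B.card) := by
  have : Nonempty V := Fintype.card_pos_iff.mp (by omega)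
  have hnot : ¬ IsKConnected G (k + 1) := fun h => by
    have := (connectivity_isGreatest G).2 h
    omega
  by_cases hk : Fintype.card V ≤ k + 1
  -- Here `k ≤ δ < n ≤ k + 1` forces `δ = k` and `n = k + 1`; a singleton against `∅` gives the
  -- complete graph.
  · obtain ⟨a⟩ := this
    exact ⟨{a}, ∅, by simp, by simp; omega, fun u v h => ⟨h.ne, by simp, by simp⟩,
      by simp; omega, Or.inl ⟨rfl, by omega⟩⟩
  · simp only [IsKConnected, not_and, not_forall] at hnot
    obtain ⟨S, hSk, hS⟩ := hnot (by omega)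
    obtain ⟨A, B, hA, hB, hAB, hABS, hno⟩ := exists_separation (by omega) hS
    wlog hle : A.card ≤ B.card generalizing A B
    · exact this B A hB hA hAB.symm (union_comm A B ▸ hABS)
        (fun u hu v hv h => hno v hv u hu h.symm) (by omega)
    have hcard : A.card + B.card + S.card = Fintype.card V := by
      rw [← card_union_of_disjoint hAB, hABS, card_compl]
      have := card_le_univ S
      omega
    have hcov : ∀ v, v ∈ A ∨ v ∈ B ∨ v ∈ S := fun v => by
      by_cases hv : v ∈ S
      · exact Or.inr (Or.inr hv)
      · exact (mem_union.mp (hABS ▸ mem_compl.mpr hv)).imp_right Or.inl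
    have hAd := lt_card_add_card_of_separated (G := G) (A := A) (S := S) (fun u hu v huv => by
      rcases hcov v with h | h | h
      exacts [mem_union_left _ h, absurd huv (hno u hu v h), mem_union_right _ h]) hA
    -- Move `k - |S|` vertices of `A` into the cut, making it exactly `k`. As `|A| + |S| > δ`, at
    -- least `δ - k + 1` vertices remain.
    obtain ⟨A', hA'A, hA'⟩ := exists_subset_card_eq (s := A) (n := A.card - (k - S.card)) (by omega)
    refine ⟨A', B, hAB.mono_left hA'A, by omega, fun u v h => ⟨h.ne, ?_, ?_⟩, by omega,
      Or.inr (by omega)⟩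
    · exact fun h' => hno u (hA'A h'.1) v h'.2 h
    · exact fun h' => hno v (hA'A h'.2) u h'.1 h.symm

end Structure

end ConnSpec

/-! ### The main theorem. -/

theorem mainTheorem1 (n k δ : ℕ) (hk : 0 < k) (hkδ : k ≤ δ)
    {V : Type*} [Fintype V] [DecidableEq V] (G : SimpleGraph V) [DecidableRel G.Adj]
    (hn : Fintype.card V = n)
    (hconn : ConnSpec.connectivity G ≤ k)
    (hdeg : δ ≤ G.minDegree) :
    (Fintype.card (Fin k ⊕ (Fin (δ - k + 1) ⊕ Fin (n - δ - 1))) = n ∧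
      (ConnSpec.extremalGraph k δ n).Connected ∧
      ConnSpec.connectivity (ConnSpec.extremalGraph k δ n) ≤ k ∧
      (ConnSpec.extremalGraph k δ n).minDegree = δ) ∧
    ConnSpec.specRadius G ≤ ConnSpec.specRadius (ConnSpec.extremalGraph k δ n) ∧
    (ConnSpec.specRadius G = ConnSpec.specRadius (ConnSpec.extremalGraph k δ n) ↔
      Nonempty (G ≃g ConnSpec.extremalGraph k δ n)) := by
  open ConnSpec Finset in
  have hV : Nonempty V := by
    by_contra hV
    rw [not_nonempty_iff] at hV
    have : G.minDegree = 0 := by simp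
    omega
  have hδ : δ < Fintype.card V := hdeg.trans_lt G.minDegree_lt_card
  obtain ⟨A, B, hAB, hcard, hGle, hAδ, hB⟩ := exists_le_sepGraph hkδ hconn hdeg hδ
  have hext := extremalGraph_eq_sepGraph k δ n
  have hdis := disjoint_extremalLeft_extremalRight k (δ - k + 1) (n - δ - 1)
  have hL := card_extremalLeft k (δ - k + 1) (n - δ - 1)
  have hR := card_extremalRight k (δ - k + 1) (n - δ - 1)
  have hcardE : Fintype.card (Fin k ⊕ (Fin (δ - k + 1) ⊕ Fin (n - δ - 1))) = n := by
    simp only [Fintype.card_sum, Fintype.card_fin]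
    omega
  have hEconn : (extremalGraph k δ n).Connected := by
    rw [hext]
    exact sepGraph_connected (s := Sum.inl ⟨0, hk⟩) (by simp [extremalLeft])
      (by simp [extremalRight])
  have hLne : (extremalLeft k (δ - k + 1) (n - δ - 1)).Nonempty := card_pos.mp (by omega)
  refine ⟨⟨hcardE, hEconn, ?_, ?_⟩, ?_⟩
  · rcases (extremalRight k (δ - k + 1) (n - δ - 1)).eq_empty_or_nonempty with h | h
    · have : Nonempty (Fin k ⊕ (Fin (δ - k + 1) ⊕ Fin (n - δ - 1))) := hEconn.nonempty
      apply connectivity_le_of_card_le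
      rw [h, card_empty] at hR
      rcases hB with hB | hB <;> omega
    · rw [hext]
      refine (connectivity_sepGraph_le hdis hLne h).trans ?_
      rw [hcardE, hL, hR]
      omega
  · rw [minDegree_of_eq_sepGraph hext hdis hLne, hcardE, hR]
    · omega
    · intro h
      have := card_pos.mpr h
      rcases hB with hB | hB <;> omega
  -- `T` is the surplus of `A` over `δ - k + 1`; moving it to `B` gives the part sizes of the
  -- extremal graph.
  have hsub : ∃ T ⊆ A, T.card = A.card - (δ - k + 1) := exists_subset_card_eq (by omega)
  obtain ⟨T, hTA, hT⟩ := hsub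
  have hdis' : Disjoint (A \ T) (B ∪ T) :=
    disjoint_union_right.mpr ⟨hAB.mono_left sdiff_subset, sdiff_disjoint⟩
  have hATcard : (A \ T).card = δ - k + 1 := by
    rw [card_sdiff_of_subset hTA]
    omega
  have hBTcard : (B ∪ T).card = n - δ - 1 := by
    rw [card_union_of_disjoint (hAB.symm.mono_right hTA)]
    omega
  obtain ⟨e⟩ := nonempty_iso_sepGraph hdis' hdis (hATcard.trans hL.symm) (hBTcard.trans hR.symm)
    (hn.trans hcardE.symm)
  rw [← hext] at e
  -- Since `k > 0`, the cut contains a vertex; it is adjacent to all others and makes `sepGraph A B`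
  -- connected.
  obtain ⟨s, -, hs⟩ := exists_mem_notMem_of_card_lt_card (s := A ∪ B) (t := univ) (by
    rw [card_union_of_disjoint hAB, card_univ]
    omega)
  rw [mem_union, not_or] at hs
  have hlt : T.Nonempty → specRadius (sepGraph A B) < specRadius (extremalGraph k δ n) :=
      fun hTne => by
    rw [← specRadius_congr e]
    have := card_pos.mpr hTne
    -- In the complete case `|A| = 1`, so there is no surplus; a nonempty `T` therefore forces `|A|
    -- ≤ |B|`.
    exact specRadius_sepGraph_lt hAB hs.1 hs.2 (by rcases hB with hB | hB <;> omega) hTA hTne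
  have hGH := specRadius_mono hGle
  rcases T.eq_empty_or_nonempty with rfl | hTne
  · rw [sdiff_empty, union_empty] at e
    have he := specRadius_congr e
    refine ⟨he ▸ hGH, fun h => ?_, fun ⟨f⟩ => specRadius_congr f⟩
    obtain rfl := eq_of_le_of_specRadius_eq (sepGraph_connected hs.1 hs.2) hGle (h.trans he.symm)
    exact ⟨e⟩
  -- With a surplus the inequality is strict, so equality of spectral radii is impossible, and with
  -- it an isomorphism.
  · have h := hGH.trans_lt (hlt hTne)
    exact ⟨h.le, fun h' => absurd h' h.ne, fun ⟨f⟩ => specRadius_congr f⟩
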